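/- There is an absolute constant $c_1>0$ with the following property. Let $(\varepsilon_n)$ be a Rademacher sequence on a probability space (independent random variables with $P(\varepsilon_n=1)=P(\varepsilon_n=-1)=\tfrac12$), let $(x_n)$ be a sequence in a Banach space, and suppose that the series $X=\sum_n \varepsilon_n x_n$ converges almost surely in norm. Then, for all real $t>0$ and $s\ge 1$, $$P(\|X\|>st)\le\left(\frac{1}{c_1}\,P(\|X\|>t)\right)^{c_1 s^2}.$$ -/

import Mathlib

open MeasureTheory ProbabilityTheory Filter Topology

/-- A Rademacher (Bernoulli) sequence on a measure space: independent random variables, each of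
which takes the values `1` and `-1` with probability `1/2` each. -/
structure IsRademacherSeq {Ω : Type*} [MeasurableSpace Ω] (P : Measure Ω) (ε : ℕ → Ω → ℝ) :
    Prop where
  measurable : ∀ n, Measurable (ε n)
  indep : iIndepFun ε P
  prob_one : ∀ n, P {ω | ε n ω = 1} = 1 / 2
  prob_neg_one : ∀ n, P {ω | ε n ω = -1} = 1 / 2

/-- `X` is the almost sure sum, in norm, of the Rademacher series `∑ εₙ xₙ`. -/
def IsRademacherSum {Ω E : Type*} [MeasurableSpace Ω] [NormedAddCommGroup E] [NormedSpace ℝ E]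
    (P : Measure Ω) (ε : ℕ → Ω → ℝ) (x : ℕ → E) (X : Ω → E) : Prop :=
  ∀ᵐ ω ∂P, Tendsto (fun N : ℕ => ∑ n ∈ Finset.range N, ε n ω • x n) atTop (𝓝 (X ω))

/-! Suppose a finite sum `∑ ±xᵢ` has norm above `t` with probability at most `q ≤ 1/12`. Two facts
combine. Small shifts are harmless: if `v ∈ [-1,1]ⁿ` and `2|v|² ≤ log (1/q)`, then `‖∑ vᵢ xᵢ‖ ≤ 3t`.
By duality this is scalar: `v` is the mean of a product law on signs whose density has squared L²
norm at most `exp |v|²`, and Cauchy–Schwarz with the fourth-moment Khintchine inequality bounds the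
exceptional event (`sum_mul_le_of_abs_signSum_le`). Most signs are near a good point: the convex set
`A` of `y ∈ [-1,1]ⁿ` with `‖∑ yᵢ xᵢ‖ ≤ t` has cube probability at least `11/12`, so Talagrand's
inequality (`cubeMean_exp_sqDist_mul_le_one`) makes squared distance `D` from `A` exponentially
unlikely. With `D = m² log (1/q) / 2`, a sign vector closer than that to `y ∈ A` differs from it by
`m` times an admissible `v`, so its sum has norm at most `(1 + 3m)t`. The remaining probability is
of order `q ^ (m²/16)`. Convergence in measure transfers this to `X`. -/

/-! ### Averages over the discrete cube. -/

/-- The sign `±1` coded by a Boolean. -/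
def boolSign (b : Bool) : ℝ := if b then 1 else -1

lemma boolSign_sq (b : Bool) : boolSign b ^ 2 = 1 := by cases b <;> norm_num [boolSign]

lemma abs_boolSign (b : Bool) : |boolSign b| = 1 := by cases b <;> norm_num [boolSign]

lemma boolSign_not (b : Bool) : boolSign (!b) = -boolSign b := by
  cases b <;> norm_num [boolSign]

/-- The uniform average of a function on the discrete cube. -/
noncomputable def cubeMean {n : ℕ} (f : (Fin n → Bool) → ℝ) : ℝ := (∑ σ, f σ) / 2 ^ n

section cubeMean

variable {n : ℕ}

lemma cubeMean_mono {f g : (Fin n → Bool) → ℝ} (h : ∀ σ, f σ ≤ g σ) :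
    cubeMean f ≤ cubeMean g := by
  unfold cubeMean
  gcongr with σ
  exact h σ

lemma cubeMean_add (f g : (Fin n → Bool) → ℝ) :
    cubeMean (fun σ => f σ + g σ) = cubeMean f + cubeMean g := by
  simp only [cubeMean, Finset.sum_add_distrib, add_div]

lemma cubeMean_const_mul (c : ℝ) (f : (Fin n → Bool) → ℝ) :
    cubeMean (fun σ => c * f σ) = c * cubeMean f := by
  simp only [cubeMean, ← Finset.mul_sum, mul_div_assoc]

lemma cubeMean_const (c : ℝ) : cubeMean (fun _ : Fin n → Bool => c) = c := by
  simp [cubeMean]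

lemma cubeMean_nonneg {f : (Fin n → Bool) → ℝ} (h : ∀ σ, 0 ≤ f σ) : 0 ≤ cubeMean f := by
  simpa only [cubeMean_const] using cubeMean_mono h

lemma cubeMean_dim_zero (f : (Fin 0 → Bool) → ℝ) : cubeMean f = f Fin.elim0 := by
  simp only [cubeMean, Finset.univ_unique, Finset.sum_singleton, pow_zero, div_one]
  exact congrArg f (Subsingleton.elim _ _)

/-- The face listed first is left free so that Talagrand's induction can choose the one with the
heavier section. -/
lemma cubeMean_succ (b : Bool) (f : (Fin (n + 1) → Bool) → ℝ) :
    cubeMean f = (cubeMean (fun σ => f (Fin.cons b σ)) +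
      cubeMean (fun σ => f (Fin.cons (!b) σ))) / 2 := by
  have h : ∑ σ, f σ = ∑ σ : Fin n → Bool, f (Fin.cons b σ)
      + ∑ σ : Fin n → Bool, f (Fin.cons (!b) σ) := by
    rw [← (Fin.consEquiv (fun _ : Fin (n + 1) => Bool)).sum_comp, Fintype.sum_prod_type,
      Fintype.sum_bool]
    cases b
    · exact add_comm _ _
    · rfl
  simp only [cubeMean, h, pow_succ]
  field_simp

lemma cubeMean_mul_sq_le (f g : (Fin n → Bool) → ℝ) :
    cubeMean (fun σ => f σ * g σ) ^ 2 ≤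
      cubeMean (fun σ => f σ ^ 2) * cubeMean (fun σ => g σ ^ 2) := by
  have h := Finset.sum_mul_sq_le_sq_mul_sq Finset.univ f g
  simp only [cubeMean]
  rw [div_pow, div_mul_div_comm, ← sq]
  gcongr

end cubeMean

/-! ### Talagrand's convex distance inequality. -/

/-- Hölder's inequality for exponentials on the cube, in logarithmic form. -/
lemma cubeMean_exp_convex_comb_le {n : ℕ} {f g : (Fin n → Bool) → ℝ} {a b θ : ℝ}
    (ha : 0 < a) (hb : 0 < b) (h0 : 0 ≤ θ) (h1 : θ ≤ 1)
    (hf : cubeMean (fun σ => Real.exp (f σ)) * a ≤ 1)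
    (hg : cubeMean (fun σ => Real.exp (g σ)) * b ≤ 1) :
    cubeMean (fun σ => Real.exp (θ * f σ + (1 - θ) * g σ)) ≤
      Real.exp (-(θ * Real.log a + (1 - θ) * Real.log b)) := by
  have key : ∀ σ, Real.exp (θ * f σ + (1 - θ) * g σ) ≤
      Real.exp (-(θ * Real.log a + (1 - θ) * Real.log b)) *
        (θ * a * Real.exp (f σ) + (1 - θ) * b * Real.exp (g σ)) := by
    intro σ
    have hc := convexOn_exp.2 (Set.mem_univ (f σ + Real.log a))
      (Set.mem_univ (g σ + Real.log b)) h0 (sub_nonneg.2 h1) (by ring)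
    simp only [smul_eq_mul, Real.exp_add, Real.exp_log ha, Real.exp_log hb] at hc
    have : Real.exp (θ * f σ + (1 - θ) * g σ) =
        Real.exp (-(θ * Real.log a + (1 - θ) * Real.log b)) *
          (Real.exp (θ * (f σ + Real.log a)) * Real.exp ((1 - θ) * (g σ + Real.log b))) := by
      rw [← Real.exp_add, ← Real.exp_add]
      congr 1
      ring
    rw [this]
    refine mul_le_mul_of_nonneg_left (hc.trans (le_of_eq ?_)) (Real.exp_pos _).le
    ring
  refine (cubeMean_mono key).trans ?_
  rw [cubeMean_const_mul, cubeMean_add, cubeMean_const_mul, cubeMean_const_mul]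
  refine mul_le_of_le_one_right (Real.exp_pos _).le ?_
  nlinarith [mul_le_mul_of_nonneg_left hf h0, mul_le_mul_of_nonneg_left hg (sub_nonneg.2 h1)]

/-- The two-point inequality behind the induction in Talagrand's theorem on the cube. -/
lemma two_point_inequality {r : ℝ} (h0 : 0 < r) (h1 : r ≤ 1) :
    Real.exp ((1 - r) ^ 2 / 2 - r * Real.log r) ≤ (3 - r) / (1 + r) := by
  have hlog : -(r * Real.log r) ≤ (1 - r ^ 2) / 2 := by
    -- `u ≤ sinh u` at `u = -log r`.
    have h := Real.self_le_sinh_iff.2 (neg_nonneg.2 (Real.log_nonpos h0.le h1))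
    rw [Real.sinh_neg, Real.sinh_log h0] at h
    have h2 := mul_le_mul_of_nonneg_left h h0.le
    have h3 : r * -((r - r⁻¹) / 2) = (1 - r ^ 2) / 2 := by field_simp; ring
    linarith
  have hpos : 0 < (3 - r) / (1 + r) := div_pos (by linarith) (by linarith)
  rw [← Real.le_log_iff_exp_le hpos]
  -- With `log (1 + x) ≥ 2x / (x + 2)` at this `x`, the right side has logarithm at least `1 - r`,
  -- which is exactly `(1 - r)²/2 + (1 - r²)/2`.
  have hx : 0 ≤ 2 * (1 - r) / (1 + r) := div_nonneg (by linarith) (by linarith)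
  have h := Real.le_log_one_add_of_nonneg hx
  have e1 : 1 + 2 * (1 - r) / (1 + r) = (3 - r) / (1 + r) := by
    field_simp
    ring
  have e2 : 2 * (2 * (1 - r) / (1 + r)) / (2 * (1 - r) / (1 + r) + 2) = 1 - r := by
    have : 2 * (1 - r) / (1 + r) + 2 = 4 / (1 + r) := by
      field_simp
      ring
    rw [this]
    field_simp
    ring
  rw [e1, e2] at h
  linarith

/-- The indicator function of a set of points of `ℝⁿ`, restricted to the cube `{1, -1}ⁿ`. -/
noncomputable def cubeIndicator {n : ℕ} (A : Set (Fin n → ℝ)) (σ : Fin n → Bool) : ℝ :=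
  A.indicator (fun _ => 1) (fun i => boolSign (σ i))

lemma cubeIndicator_nonneg {n : ℕ} (A : Set (Fin n → ℝ)) (σ : Fin n → Bool) :
    0 ≤ cubeIndicator A σ := Set.indicator_nonneg (fun _ _ => zero_le_one) _

lemma cubeIndicator_le_one {n : ℕ} (A : Set (Fin n → ℝ)) (σ : Fin n → Bool) :
    cubeIndicator A σ ≤ 1 := Set.indicator_le_self' (fun _ _ => zero_le_one) _

lemma cubeIndicator_cons {n : ℕ} (A : Set (Fin (n + 1) → ℝ)) (b : Bool) (σ : Fin n → Bool) :
    cubeIndicator A (Fin.cons b σ) = cubeIndicator {y | Fin.cons (boolSign b) y ∈ A} σ := by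
  have h : (fun i => boolSign ((Fin.cons b σ : Fin (n + 1) → Bool) i)) =
      Fin.cons (boolSign b) (fun i => boolSign (σ i)) := by
    ext i
    refine Fin.cases ?_ (fun j => ?_) i <;> simp
  simp only [cubeIndicator, Set.indicator]
  congr 1
  exact congrArg (· ∈ A) h

lemma convex_cons_section {n : ℕ} {A : Set (Fin (n + 1) → ℝ)} (hA : Convex ℝ A) (c : ℝ) :
    Convex ℝ {y : Fin n → ℝ | (Fin.cons c y : Fin (n + 1) → ℝ) ∈ A} := by
  intro y hy z hz a b ha hb hab
  have h := hA hy hz ha hb hab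
  have e : (Fin.cons c (a • y + b • z) : Fin (n + 1) → ℝ) =
      a • Fin.cons c y + b • Fin.cons c z := by
    ext i
    refine Fin.cases ?_ (fun j => ?_) i
    · simp [← add_mul, hab]
    · simp
  simpa only [Set.mem_ofPred_eq, e] using h

/-- Talagrand's isoperimetric inequality for convex sets and the discrete cube: if `g` is bounded
by the squared Euclidean distance to the convex set `A`, then `exp (g / 8)` has mean at most the
inverse of the probability of `A`. -/
theorem cubeMean_exp_sqDist_mul_le_one {n : ℕ} (A : Set (Fin n → ℝ)) (hA : Convex ℝ A)
    (g : (Fin n → Bool) → ℝ) (hg : ∀ σ, ∀ y ∈ A, g σ ≤ ∑ i, (boolSign (σ i) - y i) ^ 2) :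
    cubeMean (fun σ => Real.exp (g σ / 8)) * cubeMean (cubeIndicator A) ≤ 1 := by
  induction n with
  | zero =>
    rw [cubeMean_dim_zero, cubeMean_dim_zero]
    by_cases h : (fun i => boolSign ((Fin.elim0 : Fin 0 → Bool) i)) ∈ A
    · have h2 := hg Fin.elim0 _ h
      simp only [Finset.univ_eq_empty, Finset.sum_empty] at h2
      exact mul_le_one₀ (Real.exp_le_one_iff.2 (by linarith)) (cubeIndicator_nonneg _ _)
        (cubeIndicator_le_one _ _)
    · simp [cubeIndicator, h]
  | succ n ih =>
    set S : Bool → Set (Fin n → ℝ) :=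
      fun b => {y | (Fin.cons (boolSign b) y : Fin (n + 1) → ℝ) ∈ A}
      with hS
    have hSc : ∀ b, Convex ℝ (S b) := fun b => convex_cons_section hA _
    set α : Bool → ℝ := fun b => cubeMean (cubeIndicator (S b)) with hα
    have hα0 : ∀ b, 0 ≤ α b := fun b => cubeMean_nonneg fun σ => cubeIndicator_nonneg _ _
    obtain ⟨b, hb⟩ : ∃ b, α (!b) ≤ α b := by
      rcases le_total (α false) (α true) with h | h
      · exact ⟨true, h⟩
      · exact ⟨false, h⟩
    rw [cubeMean_succ b, cubeMean_succ b (cubeIndicator A)]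
    simp only [cubeIndicator_cons]
    change _ * ((α b + α (!b)) / 2) ≤ 1
    have hsame : ∀ σ, ∀ y ∈ S b, g (Fin.cons b σ) ≤ ∑ i, (boolSign (σ i) - y i) ^ 2 := by
      intro σ y hy
      simpa [Fin.sum_univ_succ] using hg (Fin.cons b σ) _ hy
    have hsame' : ∀ σ, ∀ y ∈ S (!b), g (Fin.cons (!b) σ) ≤ ∑ i, (boolSign (σ i) - y i) ^ 2 := by
      intro σ y hy
      simpa [Fin.sum_univ_succ] using hg (Fin.cons (!b) σ) _ hy
    have hopp : ∀ σ, ∀ y ∈ S b, g (Fin.cons (!b) σ) ≤ 4 + ∑ i, (boolSign (σ i) - y i) ^ 2 := by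
      intro σ y hy
      have h := hg (Fin.cons (!b) σ) _ hy
      rw [Fin.sum_univ_succ] at h
      simp only [Fin.cons_zero, Fin.cons_succ, boolSign_not] at h
      nlinarith [boolSign_sq b]
    -- Convexity of `A`: mixing points of both sections costs `(2θ)²` in the first coordinate.
    have hmix : ∀ θ : ℝ, 0 ≤ θ → θ ≤ 1 → ∀ σ, ∀ y ∈ S b, ∀ z ∈ S (!b), g (Fin.cons (!b) σ) ≤
        4 * θ ^ 2 + θ * ∑ i, (boolSign (σ i) - y i) ^ 2
          + (1 - θ) * ∑ i, (boolSign (σ i) - z i) ^ 2 := by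
      intro θ h0 h1 σ y hy z hz
      have h := hg (Fin.cons (!b) σ) _ (hA hy hz h0 (sub_nonneg.2 h1) (by ring))
      rw [Fin.sum_univ_succ] at h
      simp only [Fin.cons_zero, Fin.cons_succ, boolSign_not, Pi.add_apply, Pi.smul_apply,
        smul_eq_mul] at h
      have h3 : ∑ i, (boolSign (σ i) - (θ * y i + (1 - θ) * z i)) ^ 2 ≤
          θ * ∑ i, (boolSign (σ i) - y i) ^ 2 + (1 - θ) * ∑ i, (boolSign (σ i) - z i) ^ 2 := by
        rw [Finset.mul_sum, Finset.mul_sum, ← Finset.sum_add_distrib]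
        refine Finset.sum_le_sum fun i _ => ?_
        nlinarith [mul_nonneg (mul_nonneg h0 (sub_nonneg.2 h1)) (sq_nonneg (y i - z i))]
      have h4 : (-boolSign b - (θ * boolSign b + (1 - θ) * -boolSign b)) ^ 2 = 4 * θ ^ 2 := by
        have := boolSign_sq b
        linear_combination 4 * θ ^ 2 * this
      linarith
    have hF0 := ih (S b) (hSc b) _ hsame
    rcases (hα0 b).eq_or_lt with hzero | hpos
    · have : α (!b) = 0 := le_antisymm (hb.trans hzero.symm.le) (hα0 _)
      rw [this, ← hzero]
      norm_num
    have hexists : ∀ c, 0 < α c → (S c).Nonempty := by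
      intro c hc
      by_contra hne
      rw [Set.not_nonempty_iff_eq_empty] at hne
      simp only [hα, hne] at hc
      simp [cubeIndicator, cubeMean] at hc
    set F0 := cubeMean (fun σ : Fin n → Bool => Real.exp (g (Fin.cons b σ) / 8)) with hF0def
    set F1 := cubeMean (fun σ : Fin n → Bool => Real.exp (g (Fin.cons (!b) σ) / 8)) with hF1def
    change F0 * α b ≤ 1 at hF0
    rcases (hα0 (!b)).eq_or_lt with hzero' | hpos'
    · rw [← hzero']
      have h := ih (S b) (hSc b) (fun σ => g (Fin.cons (!b) σ) - 4)
        (fun σ y hy => by linarith [hopp σ y hy])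
      change cubeMean _ * α b ≤ 1 at h
      have he : cubeMean (fun σ : Fin n → Bool => Real.exp ((g (Fin.cons (!b) σ) - 4) / 8)) =
          Real.exp (-1 / 2) * F1 := by
        rw [hF1def, ← cubeMean_const_mul]
        congr 1
        ext σ
        rw [← Real.exp_add]
        congr 1
        ring
      rw [he] at h
      have hexp : (1 : ℝ) / 2 ≤ Real.exp (-1 / 2) := by
        have := Real.add_one_le_exp (-1 / 2 : ℝ)
        linarith
      have hF1 : 0 ≤ F1 := cubeMean_nonneg fun σ => (Real.exp_pos _).le
      nlinarith [mul_le_mul_of_nonneg_right hexp (mul_nonneg hF1 hpos.le)]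
    -- The mixing weight will be `θ = 1 - r`, which reduces the lighter face to
    -- `two_point_inequality`.
    · set r := α (!b) / α b with hr
      have hr0 : 0 < r := div_pos hpos' hpos
      have hr1 : r ≤ 1 := (div_le_one hpos).2 hb
      have hne := hexists _ hpos
      have hne' := hexists _ hpos'
      set D : Bool → (Fin n → Bool) → ℝ :=
        fun c (σ : Fin n → Bool) => ⨅ y : S c, ∑ i, (boolSign (σ i) - y.1 i) ^ 2 with hD
      have hbdd : ∀ c (σ : Fin n → Bool), BddBelow (Set.range fun y : S c =>
          ∑ i, (boolSign (σ i) - y.1 i) ^ 2) := by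
        intro c σ
        refine ⟨0, ?_⟩
        rintro _ ⟨y, rfl⟩
        exact Finset.sum_nonneg fun i _ => sq_nonneg _
      have hDle : ∀ c σ, ∀ y ∈ S c, D c σ ≤ ∑ i, (boolSign (σ i) - y i) ^ 2 :=
        fun c σ y hy => ciInf_le (hbdd c σ) ⟨y, hy⟩
      have hDb := ih (S b) (hSc b) (D b) (hDle b)
      have hDb' := ih (S (!b)) (hSc _) (D (!b)) (hDle _)
      have : Nonempty (S b) := hne.to_subtype
      have : Nonempty (S (!b)) := hne'.to_subtype
      have hgle : ∀ σ, g (Fin.cons (!b) σ) ≤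
          4 * (1 - r) ^ 2 + (1 - r) * D b σ + (1 - (1 - r)) * D (!b) σ := by
        intro σ
        have h1r : 0 ≤ 1 - r := by linarith
        have h2r : 0 ≤ 1 - (1 - r) := by linarith
        simp only [hD]
        rw [Real.mul_iInf_of_nonneg h1r, Real.mul_iInf_of_nonneg h2r]
        have hz : ∀ z : S (!b), g (Fin.cons (!b) σ) - 4 * (1 - r) ^ 2
            - (1 - (1 - r)) * ∑ i, (boolSign (σ i) - z.1 i) ^ 2 ≤
            ⨅ y : S b, (1 - r) * ∑ i, (boolSign (σ i) - y.1 i) ^ 2 := by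
          intro z
          refine le_ciInf fun y => ?_
          linarith [hmix (1 - r) h1r (by linarith) σ y.1 y.2 z.1 z.2]
        have hy : g (Fin.cons (!b) σ) - 4 * (1 - r) ^ 2
            - (⨅ y : S b, (1 - r) * ∑ i, (boolSign (σ i) - y.1 i) ^ 2) ≤
            ⨅ z : S (!b), (1 - (1 - r)) * ∑ i, (boolSign (σ i) - z.1 i) ^ 2 :=
          le_ciInf fun z => by linarith [hz z]
        linarith
      have hH := cubeMean_exp_convex_comb_le hpos hpos' (by linarith : 0 ≤ 1 - r)
        (by linarith) hDb hDb'
      have hF1le : F1 ≤ Real.exp ((1 - r) ^ 2 / 2) *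
          Real.exp (-((1 - r) * Real.log (α b) + (1 - (1 - r)) * Real.log (α (!b)))) := by
        refine le_trans ?_ (mul_le_mul_of_nonneg_left hH (Real.exp_pos _).le)
        rw [← cubeMean_const_mul]
        refine cubeMean_mono fun σ => ?_
        rw [← Real.exp_add]
        refine Real.exp_le_exp.2 ?_
        linarith [hgle σ]
      have hlog : Real.log (α (!b)) = Real.log (α b) + Real.log r := by
        rw [hr, Real.log_div hpos'.ne' hpos.ne']
        ring
      have hF1' : F1 * α b ≤ (3 - r) / (1 + r) := by
        refine le_trans ?_ (two_point_inequality hr0 hr1)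
        calc F1 * α b ≤ Real.exp ((1 - r) ^ 2 / 2) *
          Real.exp (-((1 - r) * Real.log (α b) + (1 - (1 - r)) * Real.log (α (!b)))) *
            Real.exp (Real.log (α b)) := by
              rw [Real.exp_log hpos]
              exact mul_le_mul_of_nonneg_right hF1le hpos.le
          _ = Real.exp ((1 - r) ^ 2 / 2 - r * Real.log r) := by
              rw [← Real.exp_add, ← Real.exp_add, hlog]
              congr 1
              ring
      have hα' : α (!b) = r * α b := by
        rw [hr]
        field_simp
      rw [hα']
      have hsum : (F0 + F1) * α b ≤ 4 / (1 + r) := by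
        have : 4 / (1 + r) = 1 + (3 - r) / (1 + r) := by
          field_simp
          ring
        rw [this]
        linarith
      have h5 : (F0 + F1) * α b * (1 + r) ≤ 4 := (le_div_iff₀ (by linarith)).1 hsum
      linarith

/-! ### Moments of sign sums and tilted product laws. -/

lemma cubeMean_succ_eq_mean {n : ℕ} (f : (Fin (n + 1) → Bool) → ℝ) :
    cubeMean f = cubeMean (fun σ => 1 / 2 * (f (Fin.cons true σ) + f (Fin.cons false σ))) := by
  rw [cubeMean_succ true, cubeMean_const_mul, cubeMean_add]
  simp only [Bool.not_true]
  ring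

/-- A real linear form evaluated at a point of the discrete cube. -/
def signSum {n : ℕ} (a : Fin n → ℝ) (σ : Fin n → Bool) : ℝ := ∑ i, boolSign (σ i) * a i

/-- The density of the product of two-point laws on `{1, -1}` with means `v i`. -/
def tiltDensity {n : ℕ} (v : Fin n → ℝ) (σ : Fin n → Bool) : ℝ := ∏ i, (1 + boolSign (σ i) * v i)

section moments

variable {n : ℕ}

lemma signSum_cons (a : Fin (n + 1) → ℝ) (b : Bool) (σ : Fin n → Bool) :
    signSum a (Fin.cons b σ) = boolSign b * a 0 + signSum (fun i => a i.succ) σ := by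
  simp [signSum, Fin.sum_univ_succ]

lemma tiltDensity_cons (v : Fin (n + 1) → ℝ) (b : Bool) (σ : Fin n → Bool) :
    tiltDensity v (Fin.cons b σ) = (1 + boolSign b * v 0) * tiltDensity (fun i => v i.succ) σ := by
  simp [tiltDensity, Fin.prod_univ_succ]

lemma tiltDensity_nonneg {v : Fin n → ℝ} (hv : ∀ i, |v i| ≤ 1) (σ : Fin n → Bool) :
    0 ≤ tiltDensity v σ := by
  refine Finset.prod_nonneg fun i _ => ?_
  have h : |boolSign (σ i) * v i| ≤ 1 := by
    rw [abs_mul, abs_boolSign, one_mul]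
    exact hv i
  linarith [(abs_le.1 h).1]

lemma cubeMean_signSum_sq (a : Fin n → ℝ) :
    cubeMean (fun σ => signSum a σ ^ 2) = ∑ i, a i ^ 2 := by
  induction n with
  | zero => simp [cubeMean_dim_zero, signSum]
  | succ n ih =>
    rw [cubeMean_succ_eq_mean, Fin.sum_univ_succ, ← ih, ← cubeMean_const (n := n) (a 0 ^ 2),
      ← cubeMean_add]
    congr 1
    ext σ
    simp only [signSum_cons, boolSign, if_true, Bool.false_eq_true, if_false]
    ring

/-- Khintchine's inequality for fourth moments. -/
lemma cubeMean_signSum_pow_four_le (a : Fin n → ℝ) :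
    cubeMean (fun σ => signSum a σ ^ 4) ≤ 3 * (∑ i, a i ^ 2) ^ 2 := by
  induction n with
  | zero => simp [cubeMean_dim_zero, signSum]
  | succ n ih =>
    have h : cubeMean (fun σ => signSum a σ ^ 4) = a 0 ^ 4
        + (6 * a 0 ^ 2 * ∑ i : Fin n, a i.succ ^ 2
          + cubeMean (fun σ => signSum (fun i => a i.succ) σ ^ 4)) := by
      rw [cubeMean_succ_eq_mean, ← cubeMean_signSum_sq, ← cubeMean_const (n := n) (a 0 ^ 4),
        ← cubeMean_const_mul, ← cubeMean_add, ← cubeMean_add]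
      congr 1
      ext σ
      simp only [signSum_cons, boolSign, if_true, Bool.false_eq_true, if_false]
      ring
    rw [h, Fin.sum_univ_succ]
    nlinarith [ih fun i => a i.succ, sq_nonneg (a 0 ^ 2)]

lemma cubeMean_tiltDensity (v : Fin n → ℝ) : cubeMean (tiltDensity v) = 1 := by
  induction n with
  | zero => simp [cubeMean_dim_zero, tiltDensity]
  | succ n ih =>
    rw [cubeMean_succ_eq_mean]
    refine Eq.trans (congrArg cubeMean ?_) (ih fun i => v i.succ)
    ext σ
    simp only [tiltDensity_cons, boolSign, if_true, Bool.false_eq_true, if_false]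
    ring

lemma cubeMean_tiltDensity_mul_signSum (v a : Fin n → ℝ) :
    cubeMean (fun σ => tiltDensity v σ * signSum a σ) = ∑ i, v i * a i := by
  induction n with
  | zero => simp [cubeMean_dim_zero, signSum]
  | succ n ih =>
    have h1 : v 0 * a 0 = v 0 * a 0 * cubeMean (tiltDensity fun i => v i.succ) := by
      rw [cubeMean_tiltDensity, mul_one]
    rw [cubeMean_succ_eq_mean, Fin.sum_univ_succ, ← ih, h1, ← cubeMean_const_mul, ← cubeMean_add]
    congr 1
    ext σ
    simp only [signSum_cons, tiltDensity_cons, boolSign, if_true, Bool.false_eq_true, if_false]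
    ring

lemma cubeMean_tiltDensity_sq_le (v : Fin n → ℝ) :
    cubeMean (fun σ => tiltDensity v σ ^ 2) ≤ Real.exp (∑ i, v i ^ 2) := by
  induction n with
  | zero => simp [cubeMean_dim_zero, tiltDensity]
  | succ n ih =>
    have h : cubeMean (fun σ => tiltDensity v σ ^ 2) =
        (1 + v 0 ^ 2) * cubeMean (fun σ => tiltDensity (fun i => v i.succ) σ ^ 2) := by
      rw [cubeMean_succ_eq_mean, ← cubeMean_const_mul]
      congr 1
      ext σ
      simp only [tiltDensity_cons, boolSign, if_true, Bool.false_eq_true, if_false]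
      ring
    rw [h, Fin.sum_univ_succ, Real.exp_add]
    refine mul_le_mul ?_ (ih _) (cubeMean_nonneg fun σ => sq_nonneg _) (Real.exp_pos _).le
    linarith [Real.add_one_le_exp (v 0 ^ 2)]

/-- If `|∑ ±aᵢ| ≤ t` outside a small set of signs, then `∑ vᵢ aᵢ ≤ 3t` for all `v` in the unit
cube whose Euclidean norm is controlled by the measure of the exceptional set. -/
lemma sum_mul_le_of_abs_signSum_le {a v : Fin n → ℝ} {B : (Fin n → Bool) → ℝ} {t q : ℝ}
    (ht : 0 ≤ t) (hB : ∀ σ, B σ = 1 ∨ B σ = 0 ∧ |signSum a σ| ≤ t) (hBq : cubeMean B ≤ q)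
    (hq : q ≤ 1 / 12) (hv : ∀ i, |v i| ≤ 1) (hvq : Real.exp (2 * ∑ i, v i ^ 2) * q ≤ 1) :
    ∑ i, v i * a i ≤ 3 * t := by
  set V := ∑ i, a i ^ 2 with hV
  have hV0 : 0 ≤ V := Finset.sum_nonneg fun i _ => sq_nonneg _
  have hBB : ∀ σ, B σ ^ 2 = B σ := by
    intro σ
    rcases hB σ with h | ⟨h, -⟩ <;> simp [h]
  have hB0 : ∀ σ, 0 ≤ B σ := fun σ => hBB σ ▸ sq_nonneg _
  have hq0 : 0 ≤ q := (cubeMean_nonneg hB0).trans hBq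
  set G := cubeMean (fun σ => signSum a σ ^ 2 * B σ) with hG
  have hG0 : 0 ≤ G := cubeMean_nonneg fun σ => mul_nonneg (sq_nonneg _) (hB0 σ)
  have hG2 : G ^ 2 ≤ 3 * V ^ 2 * q := by
    have h := cubeMean_mul_sq_le (fun σ => signSum a σ ^ 2) B
    simp only [hBB, ← pow_mul] at h
    exact h.trans (mul_le_mul (cubeMean_signSum_pow_four_le a) hBq (cubeMean_nonneg hB0)
      (by positivity))
  -- The variance cannot live on the exceptional set: `q ≤ 1/12` turns `hG2` into `G ≤ V / 2`.
  have hVt : V ≤ 2 * t ^ 2 := by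
    have h1 : V ≤ t ^ 2 + G := by
      rw [hV, ← cubeMean_signSum_sq, hG, ← cubeMean_const (n := n) (t ^ 2), ← cubeMean_add]
      refine cubeMean_mono fun σ => ?_
      rcases hB σ with h | ⟨h, h'⟩
      · rw [h]
        nlinarith [sq_nonneg t]
      · rw [h, mul_zero, add_zero, ← sq_abs]
        gcongr
    have h2 : G ≤ V / 2 := by
      refine le_of_sq_le_sq ?_ (by positivity)
      nlinarith [mul_le_mul_of_nonneg_left hq (sq_nonneg V)]
    linarith
  set R := cubeMean (fun σ => tiltDensity v σ * (|signSum a σ| * B σ)) with hR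
  have hR0 : 0 ≤ R := cubeMean_nonneg fun σ =>
    mul_nonneg (tiltDensity_nonneg hv σ) (mul_nonneg (abs_nonneg _) (hB0 σ))
  have hR2 : R ^ 2 ≤ Real.exp (∑ i, v i ^ 2) * G := by
    have h := cubeMean_mul_sq_le (tiltDensity v) (fun σ => |signSum a σ| * B σ)
    simp only [mul_pow, hBB, sq_abs] at h
    exact h.trans (mul_le_mul_of_nonneg_right (cubeMean_tiltDensity_sq_le v) hG0)
  -- The fourth power produces `exp (2|v|²) * q`, the quantity bounded by `hvq`.
  have hR4 : R ^ 4 ≤ (2 * t) ^ 4 := by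
    calc R ^ 4 = (R ^ 2) ^ 2 := by ring
      _ ≤ (Real.exp (∑ i, v i ^ 2) * G) ^ 2 := by gcongr
      _ = Real.exp (2 * ∑ i, v i ^ 2) * G ^ 2 := by
        rw [mul_pow, ← Real.exp_nat_mul]
        norm_num
      _ ≤ Real.exp (2 * ∑ i, v i ^ 2) * (3 * V ^ 2 * q) := by gcongr
      _ = (Real.exp (2 * ∑ i, v i ^ 2) * q) * (3 * V ^ 2) := by ring
      _ ≤ 1 * (3 * V ^ 2) := by gcongr
      _ ≤ 1 * (3 * (2 * t ^ 2) ^ 2) := by gcongr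
      _ ≤ (2 * t) ^ 4 := by nlinarith [sq_nonneg (t ^ 2)]
  have hRt : R ≤ 2 * t := le_of_pow_le_pow_left₀ (by norm_num) (by positivity) hR4
  have hmain : ∑ i, v i * a i ≤ t + R := by
    have h1 : t = t * cubeMean (tiltDensity v) := by rw [cubeMean_tiltDensity, mul_one]
    rw [h1, ← cubeMean_tiltDensity_mul_signSum, ← cubeMean_const_mul, hR, ← cubeMean_add]
    refine cubeMean_mono fun σ => ?_
    have hw := tiltDensity_nonneg hv σ
    rcases hB σ with h | ⟨h, h'⟩
    · rw [h]
      nlinarith [mul_le_mul_of_nonneg_left (le_abs_self (signSum a σ)) hw, mul_nonneg ht hw]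
    · rw [h]
      nlinarith [mul_le_mul_of_nonneg_left ((le_abs_self (signSum a σ)).trans h') hw]
  linarith

end moments

/-! ### Tail comparison for finite vector-valued sums. -/

section norms

variable {E : Type*} [NormedAddCommGroup E] [NormedSpace ℝ E] {n : ℕ}

open Classical in
/-- The indicator, on the discrete cube, of the event that `∑ ±xᵢ` has norm larger than `t`. -/
noncomputable def exceedIndicator (x : Fin n → E) (t : ℝ) (σ : Fin n → Bool) : ℝ :=
  if t < ‖∑ i, boolSign (σ i) • x i‖ then 1 else 0

/-- A norming functional reduces this to the scalar case: it sends the vector sums to sign sums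
without increasing their size. -/
lemma norm_sum_smul_le_of_cubeMean_le {x : Fin n → E} {v : Fin n → ℝ} {t q : ℝ}
    (ht : 0 ≤ t) (hBq : cubeMean (exceedIndicator x t) ≤ q)
    (hq : q ≤ 1 / 12) (hv : ∀ i, |v i| ≤ 1) (hvq : Real.exp (2 * ∑ i, v i ^ 2) * q ≤ 1) :
    ‖∑ i, v i • x i‖ ≤ 3 * t := by
  obtain ⟨f, hf1, hf⟩ := exists_dual_vector'' ℝ (∑ i, v i • x i)
  have h := sum_mul_le_of_abs_signSum_le (a := fun i => f (x i)) ht (B := exceedIndicator x t)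
    (fun σ => ?_) hBq hq hv hvq
  · simp only [map_sum, map_smul, smul_eq_mul] at hf
    exact hf.symm.le.trans h
  · by_cases hσ : t < ‖∑ i, boolSign (σ i) • x i‖
    · exact Or.inl (if_pos hσ)
    · refine Or.inr ⟨if_neg hσ, ?_⟩
      have e : signSum (fun i => f (x i)) σ = f (∑ i, boolSign (σ i) • x i) := by
        simp [signSum, map_sum]
      rw [e, ← Real.norm_eq_abs]
      exact (f.le_of_opNorm_le hf1 _).trans (by linarith)

/-- Tail comparison for finite Rademacher sums. -/
lemma cubeMean_exceedIndicator_le {x : Fin n → E} {t q m : ℝ}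
    (ht : 0 ≤ t) (hBq : cubeMean (exceedIndicator x t) ≤ q) (hq0 : 0 < q)
    (hq : q ≤ 1 / 12) (hm : 2 ≤ m) :
    cubeMean (exceedIndicator x ((1 + 3 * m) * t)) ≤ 12 / 11 * q ^ (m ^ 2 / 16) := by
  -- The box constraint keeps the coordinates of `(σ - y) / m` at most `2 / m ≤ 1`.
  set A : Set (Fin n → ℝ) := {y | ‖∑ i, y i • x i‖ ≤ t} ∩ {y | ∀ i, |y i| ≤ 1} with hAdef
  have hA : Convex ℝ A := by
    refine Convex.inter ?_ ?_
    · intro y hy z hz a b ha hb hab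
      have e : ∑ i, (a • y + b • z) i • x i = a • ∑ i, y i • x i + b • ∑ i, z i • x i := by
        simp only [Finset.smul_sum, ← Finset.sum_add_distrib, smul_smul, ← add_smul]
        rfl
      change ‖_‖ ≤ t
      rw [e]
      refine (norm_add_le _ _).trans ?_
      rw [norm_smul, norm_smul, Real.norm_of_nonneg ha, Real.norm_of_nonneg hb]
      have h1 : ‖∑ i, y i • x i‖ ≤ t := hy
      have h2 : ‖∑ i, z i • x i‖ ≤ t := hz
      calc _ ≤ a * t + b * t := by gcongr
        _ = t := by rw [← add_mul, hab, one_mul]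
    · intro y hy z hz a b ha hb hab i
      have h1 : |y i| ≤ 1 := hy i
      have h2 : |z i| ≤ 1 := hz i
      refine (abs_add_le _ _).trans ?_
      change |a * y i| + |b * z i| ≤ 1
      rw [abs_mul, abs_mul, abs_of_nonneg ha, abs_of_nonneg hb]
      nlinarith
  set D := m ^ 2 * (-Real.log q / 2) with hD
  have hlogq : Real.log q ≤ 0 := Real.log_nonpos hq0.le (by linarith)
  have hg : ∀ σ : Fin n → Bool, ∀ y ∈ A, D * exceedIndicator x ((1 + 3 * m) * t) σ ≤
      ∑ i, (boolSign (σ i) - y i) ^ 2 := by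
    intro σ y hy
    unfold exceedIndicator
    split_ifs with hσ
    swap
    · rw [mul_zero]
      exact Finset.sum_nonneg fun i _ => sq_nonneg _
    rw [mul_one]
    by_contra! hlt
    have hm0 : 0 < m := by linarith
    have hbound := norm_sum_smul_le_of_cubeMean_le (v := fun i => m⁻¹ * (boolSign (σ i) - y i))
      ht hBq hq ?_ ?_
    · have e : ∑ i, (m⁻¹ * (boolSign (σ i) - y i)) • x i =
          m⁻¹ • (∑ i, boolSign (σ i) • x i - ∑ i, y i • x i) := by
        simp only [mul_smul, sub_smul, Finset.smul_sum, smul_sub, Finset.sum_sub_distrib]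
      rw [e, norm_smul, norm_inv, Real.norm_of_nonneg hm0.le, inv_mul_le_iff₀ hm0] at hbound
      have h1 : ‖∑ i, y i • x i‖ ≤ t := hy.1
      have h2 := norm_sub_norm_le (∑ i, boolSign (σ i) • x i) (∑ i, y i • x i)
      linarith
    · intro i
      have h1 : |y i| ≤ 1 := hy.2 i
      have h2 := abs_sub (boolSign (σ i)) (y i)
      rw [abs_boolSign] at h2
      rw [abs_mul, abs_inv, abs_of_pos hm0, inv_mul_le_iff₀ hm0]
      linarith
    · have h3 : ∑ i, (m⁻¹ * (boolSign (σ i) - y i)) ^ 2 ≤ -Real.log q / 2 := by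
        simp only [mul_pow, ← Finset.mul_sum, inv_pow]
        rw [inv_mul_le_iff₀ (by positivity)]
        exact hlt.le
      calc Real.exp (2 * ∑ i, (m⁻¹ * (boolSign (σ i) - y i)) ^ 2) * q
          ≤ Real.exp (-Real.log q) * q := by
            gcongr
            linarith
        _ = 1 := by
          rw [Real.exp_neg, Real.exp_log hq0, inv_mul_cancel₀ hq0.ne']
  have hT := cubeMean_exp_sqDist_mul_le_one A hA _ hg
  have hAmean : 11 / 12 ≤ cubeMean (cubeIndicator A) := by
    have h : 1 ≤ cubeMean (cubeIndicator A) + cubeMean (exceedIndicator x t) := by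
      rw [← cubeMean_add, ← cubeMean_const (n := n) 1]
      refine cubeMean_mono fun σ => ?_
      by_cases hσ : t < ‖∑ i, boolSign (σ i) • x i‖
      · have : exceedIndicator x t σ = 1 := if_pos hσ
        linarith [cubeIndicator_nonneg A σ]
      · have h0 : exceedIndicator x t σ = 0 := if_neg hσ
        have h1 : cubeIndicator A σ = 1 :=
          Set.indicator_of_mem
            (show (fun i => boolSign (σ i)) ∈ A from
              ⟨not_lt.1 hσ, fun i => (abs_boolSign _).le⟩) _
        rw [h0, h1, add_zero]
    linarith
  have hlow : Real.exp (D / 8) * cubeMean (exceedIndicator x ((1 + 3 * m) * t)) ≤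
      cubeMean (fun σ => Real.exp (D * exceedIndicator x ((1 + 3 * m) * t) σ / 8)) := by
    rw [← cubeMean_const_mul]
    refine cubeMean_mono fun σ => ?_
    unfold exceedIndicator
    split_ifs
    · simp
    · simp
  have hq' : q ^ (m ^ 2 / 16) = (Real.exp (D / 8))⁻¹ := by
    rw [← Real.exp_neg, Real.rpow_def_of_pos hq0]
    congr 1
    rw [hD]
    ring
  have hM : 0 ≤ cubeMean (exceedIndicator x ((1 + 3 * m) * t)) :=
    cubeMean_nonneg fun σ => by unfold exceedIndicator; split_ifs <;> norm_num
  have hfin : Real.exp (D / 8) * cubeMean (exceedIndicator x ((1 + 3 * m) * t)) * (11 / 12) ≤ 1 :=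
    (mul_le_mul hlow hAmean (by norm_num)
      ((mul_nonneg (Real.exp_pos _).le hM).trans hlow)).trans hT
  rw [hq', ← div_eq_mul_inv, le_div_iff₀ (Real.exp_pos _)]
  linarith

end norms

/-! ### From Rademacher sequences to the cube. -/

namespace IsRademacherSeq

variable {Ω : Type*} [MeasurableSpace Ω] {P : Measure Ω} {ε : ℕ → Ω → ℝ}

lemma measurableSet_eq (hε : IsRademacherSeq P ε) (n : ℕ) (c : ℝ) :
    MeasurableSet {ω | ε n ω = c} := hε.measurable n (measurableSet_singleton c)

/-- The first `n` signs of a Rademacher sequence, as a point of the discrete cube. -/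
noncomputable def signVector (ε : ℕ → Ω → ℝ) (n : ℕ) (ω : Ω) (i : Fin n) : Bool :=
  decide (0 < ε i ω)

lemma measurable_signVector (hε : IsRademacherSeq P ε) (n : ℕ) :
    Measurable (signVector ε n) :=
  measurable_pi_lambda _ fun i =>
    measurable_to_bool (by
      have : (fun ω => signVector ε n ω i) ⁻¹' {true} = ε i ⁻¹' Set.Ioi 0 := by
        ext ω
        simp [signVector]
      rw [this]
      exact hε.measurable i measurableSet_Ioi)

variable [IsProbabilityMeasure P]

lemma ae_eq_one_or (hε : IsRademacherSeq P ε) (n : ℕ) : ∀ᵐ ω ∂P, ε n ω = 1 ∨ ε n ω = -1 := by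
  have hd : Disjoint {ω | ε n ω = 1} {ω | ε n ω = -1} := by
    rw [Set.disjoint_left]
    intro ω (h1 : ε n ω = 1) (h2 : ε n ω = -1)
    linarith
  have h : P ({ω | ε n ω = 1} ∪ {ω | ε n ω = -1}) = 1 := by
    rw [measure_union hd (hε.measurableSet_eq n _), hε.prob_one, hε.prob_neg_one]
    exact ENNReal.add_halves 1
  exact (prob_compl_eq_zero_iff ((hε.measurableSet_eq n _).union (hε.measurableSet_eq n _))).2 h

lemma ae_eq_boolSign (hε : IsRademacherSeq P ε) (n : ℕ) :
    ∀ᵐ ω ∂P, ∀ i : Fin n, ε i ω = boolSign (signVector ε n ω i) := by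
  refine ae_all_iff.2 fun i => ?_
  filter_upwards [hε.ae_eq_one_or i] with ω hω
  rcases hω with h | h <;> norm_num [signVector, boolSign, h]

lemma measure_decide_eq (hε : IsRademacherSeq P ε) (n : ℕ) (b : Bool) :
    P (ε n ⁻¹' {y | decide (0 < y) = b}) = 1 / 2 := by
  have h : (ε n ⁻¹' {y | decide (0 < y) = b} : Set Ω) =ᵐ[P] {ω | ε n ω = boolSign b} := by
    rw [Filter.eventuallyEq_set]
    filter_upwards [hε.ae_eq_one_or n] with ω hω
    change decide (0 < ε n ω) = b ↔ ε n ω = boolSign b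
    rcases hω with h | h <;> cases b <;> norm_num [boolSign, h]
  rw [measure_congr h]
  cases b
  · exact hε.prob_neg_one n
  · exact hε.prob_one n

lemma measure_signVector_eq (hε : IsRademacherSeq P ε) (n : ℕ) (σ : Fin n → Bool) :
    P.real (signVector ε n ⁻¹' {σ}) = (2 ^ n)⁻¹ := by
  have hset : signVector ε n ⁻¹' {σ} =
      ⋂ i ∈ (Finset.univ : Finset (Fin n)), ε i ⁻¹' {y | decide (0 < y) = σ i} := by
    ext ω
    simp [funext_iff, signVector]
  have hmeas : ∀ b : Bool, MeasurableSet {y : ℝ | decide (0 < y) = b} := by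
    intro b
    cases b
    · simp only [decide_eq_false_iff_not, not_lt]
      exact measurableSet_Iic
    · simp only [decide_eq_true_eq]
      exact measurableSet_Ioi
  have h := (hε.indep.precomp (Fin.val_injective (n := n))).measure_inter_preimage_eq_mul
    Finset.univ (sets := fun i => {y | decide (0 < y) = σ i}) (fun i _ => hmeas _)
  rw [measureReal_def, hset]
  rw [h]
  simp only [hε.measure_decide_eq]
  simp

/-- Tail probabilities of a finite Rademacher sum are averages over the discrete cube. -/
lemma measureReal_lt_norm_sum (hε : IsRademacherSeq P ε) {E : Type*} [NormedAddCommGroup E]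
    [NormedSpace ℝ E] (x : ℕ → E) (n : ℕ) (t : ℝ) :
    P.real {ω | t < ‖∑ k ∈ Finset.range n, ε k ω • x k‖} =
      cubeMean (exceedIndicator (fun i : Fin n => x i) t) := by
  classical
  set S : Finset (Fin n → Bool) :=
    Finset.univ.filter fun σ => t < ‖∑ i, boolSign (σ i) • x i‖ with hS
  have h : {ω | t < ‖∑ k ∈ Finset.range n, ε k ω • x k‖} =ᵐ[P] signVector ε n ⁻¹' S := by
    rw [Filter.eventuallyEq_set]
    filter_upwards [hε.ae_eq_boolSign n] with ω hω
    simp [hS, Finset.sum_range, hω]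
  rw [measureReal_congr h, ← sum_measureReal_preimage_singleton S
    fun σ _ => hε.measurable_signVector n (measurableSet_singleton σ)]
  simp only [hε.measure_signVector_eq, cubeMean, exceedIndicator, Finset.sum_const, hS,
    Finset.sum_boole, nsmul_eq_mul]
  rw [div_eq_mul_inv]

end IsRademacherSeq

/-! ### Passage to the limit and choice of constants. -/

/-- Tail comparison for almost surely convergent Rademacher series. -/
lemma IsRademacherSum.measureReal_le {Ω : Type*} [MeasurableSpace Ω] {P : Measure Ω}
    [IsProbabilityMeasure P] {E : Type*} [NormedAddCommGroup E] [NormedSpace ℝ E]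
    {ε : ℕ → Ω → ℝ} {x : ℕ → E} {X : Ω → E} (hε : IsRademacherSeq P ε)
    (hX : IsRademacherSum P ε x X) {t q m : ℝ} (ht : 0 < t) (hpq : P.real {ω | t < ‖X ω‖} < q)
    (hq : q ≤ 1 / 12) (hm : 2 ≤ m) :
    P.real {ω | (3 + 6 * m) * t < ‖X ω‖} ≤ 12 / 11 * q ^ (m ^ 2 / 16) := by
  set S : ℕ → Ω → E := fun N ω => ∑ n ∈ Finset.range N, ε n ω • x n with hS
  have hSm : ∀ N, AEStronglyMeasurable (S N) P := fun N =>
    Finset.aestronglyMeasurable_fun_sum _ fun n _ =>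
      ((hε.measurable n).aestronglyMeasurable).smul_const _
  have hmeas : TendstoInMeasure P S atTop X := tendstoInMeasure_of_tendsto_ae hSm hX
  have herr : Tendsto (fun N => P.real {ω | t ≤ ‖S N ω - X ω‖}) atTop (𝓝 0) := by
    have h := tendstoInMeasure_iff_norm.1 hmeas t ht
    have h2 := (ENNReal.tendsto_toReal ENNReal.zero_ne_top).comp h
    rwa [ENNReal.toReal_zero] at h2
  have hq0 : 0 < q := measureReal_nonneg.trans_lt hpq
  have hbound : ∀ᶠ N in atTop, P.real {ω | (3 + 6 * m) * t < ‖X ω‖} ≤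
      12 / 11 * q ^ (m ^ 2 / 16) + P.real {ω | t ≤ ‖S N ω - X ω‖} := by
    -- The strict gap `q - p`, with `p` the tail of `X` at `t`, absorbs the approximation error at
    -- level `2t`; the return to `X` costs one more `t`, since `3 + 6m = 2(1 + 3m) + 1`.
    filter_upwards [herr.eventually_lt_const (sub_pos.2 hpq)] with N hN
    have h1 : P.real {ω | 2 * t < ‖S N ω‖} ≤ q := by
      have hsub : {ω | 2 * t < ‖S N ω‖} ⊆ {ω | t < ‖X ω‖} ∪ {ω | t ≤ ‖S N ω - X ω‖} := by
        intro ω (hω : 2 * t < ‖S N ω‖)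
        by_contra hcon
        simp only [Set.mem_union, Set.mem_ofPred_eq, not_or, not_lt, not_le] at hcon
        have := norm_sub_norm_le (S N ω) (X ω)
        linarith [hcon.1, hcon.2]
      have := (measureReal_mono hsub).trans (measureReal_union_le (μ := P) _ _)
      linarith
    rw [hε.measureReal_lt_norm_sum] at h1
    have h2 := cubeMean_exceedIndicator_le (by positivity) h1 hq0 hq hm
    rw [← hε.measureReal_lt_norm_sum] at h2
    have hsub : {ω | (3 + 6 * m) * t < ‖X ω‖} ⊆
        {ω | (1 + 3 * m) * (2 * t) < ‖S N ω‖} ∪ {ω | t ≤ ‖S N ω - X ω‖} := by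
      intro ω (hω : (3 + 6 * m) * t < ‖X ω‖)
      by_contra hcon
      simp only [Set.mem_union, Set.mem_ofPred_eq, not_or, not_lt, not_le] at hcon
      have := norm_sub_norm_le (X ω) (S N ω)
      rw [norm_sub_rev] at this
      linarith [hcon.1, hcon.2]
    have := (measureReal_mono hsub).trans (measureReal_union_le (μ := P) _ _)
    linarith
  have hlim := herr.const_add (12 / 11 * q ^ (m ^ 2 / 16))
  rw [add_zero] at hlim
  exact ge_of_tendsto hlim hbound

theorem corollary2 :
    ∃ c₁ : ℝ, 0 < c₁ ∧
      ∀ (Ω : Type*) [MeasurableSpace Ω] (P : Measure Ω) [IsProbabilityMeasure P]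
        (E : Type*) [NormedAddCommGroup E] [NormedSpace ℝ E] [CompleteSpace E]
        (ε : ℕ → Ω → ℝ) (x : ℕ → E) (X : Ω → E),
        IsRademacherSeq P ε → IsRademacherSum P ε x X →
          ∀ t s : ℝ, 0 < t → 1 ≤ s →
            P.real {ω | s * t < ‖X ω‖} ≤
              ((1 / c₁) * P.real {ω | t < ‖X ω‖}) ^ (c₁ * s ^ 2) := by
  refine ⟨1 / 1024, by norm_num, ?_⟩
  intro Ω _ P _ E _ _ _ ε x X hε hX t s ht hs
  rw [one_div_one_div]
  set p := P.real {ω | t < ‖X ω‖} with hp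
  have hp0 : 0 ≤ p := measureReal_nonneg
  have hexp : 0 ≤ 1 / 1024 * s ^ 2 := by positivity
  have hmono : P.real {ω | s * t < ‖X ω‖} ≤ p := by
    refine measureReal_mono fun ω (hω : s * t < ‖X ω‖) => ?_
    change t < ‖X ω‖
    nlinarith
  rcases hp0.eq_or_lt with hzero | hpos
  · exact (hmono.trans hzero.symm.le).trans (by positivity)
  by_cases hbig : 1 / 24 < p
  · exact measureReal_le_one.trans (Real.one_le_rpow (by linarith) hexp)
  push Not at hbig
  by_cases hsmall : s < 16
  · have he : 1 / 1024 * s ^ 2 ≤ 1 := by nlinarith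
    calc P.real {ω | s * t < ‖X ω‖} ≤ p := hmono
      _ = p ^ (1 : ℝ) := (Real.rpow_one p).symm
      _ ≤ p ^ (1 / 1024 * s ^ 2) := Real.rpow_le_rpow_of_exponent_ge hpos (by linarith) he
      _ ≤ (1024 * p) ^ (1 / 1024 * s ^ 2) := Real.rpow_le_rpow hp0 (by linarith) hexp
  push Not at hsmall
  -- Here `q = 2p` is at most `1/12`; since `1024 = 512 * 2`, the factor `512` is left to absorb
  -- `12/11`.
  have hm : 2 ≤ (s - 3) / 6 := by linarith
  have h := hX.measureReal_le hε ht (q := 2 * p) (by linarith) (by linarith) hm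
  have e : 3 + 6 * ((s - 3) / 6) = s := by ring
  rw [e] at h
  have hexp2 : 1 / 1024 * s ^ 2 ≤ ((s - 3) / 6) ^ 2 / 16 := by nlinarith
  have hquarter : (12 / 11 : ℝ) ≤ 512 ^ (1 / 1024 * s ^ 2) := by
    calc (12 / 11 : ℝ) ≤ 16 ^ (1 / 4 : ℝ) := by
          rw [show (16 : ℝ) = 2 ^ (4 : ℝ) by norm_num, ← Real.rpow_mul (by norm_num)]
          norm_num
      _ ≤ 512 ^ (1 / 4 : ℝ) := by gcongr; norm_num
      _ ≤ 512 ^ (1 / 1024 * s ^ 2) :=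
        Real.rpow_le_rpow_of_exponent_le (by norm_num) (by nlinarith)
  calc P.real {ω | s * t < ‖X ω‖} ≤ 12 / 11 * (2 * p) ^ (((s - 3) / 6) ^ 2 / 16) := h
    _ ≤ 512 ^ (1 / 1024 * s ^ 2) * (2 * p) ^ (1 / 1024 * s ^ 2) := by
      refine mul_le_mul hquarter ?_ (by positivity) (by positivity)
      exact Real.rpow_le_rpow_of_exponent_ge (by linarith) (by linarith) hexp2
    _ = (1024 * p) ^ (1 / 1024 * s ^ 2) := by
      rw [← Real.mul_rpow (by norm_num) (by linarith)]
      congr 1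
      ring
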